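/- \textbf{Setting.} Let $\Sigma$ be a finite vocabulary of predicate and function symbols (with arities), $\Sigma_P$ its set of predicate symbols. An interpretation is an arbitrary $\Sigma$-structure with non-empty domain (not necessarily Herbrand). A \emph{core ASP program} over $\Sigma$ is a finite set of rules of three kinds: choice rules $\{A\}\leftarrow \beta$, normal rules $A\leftarrow\beta$, and constraints $\leftarrow\beta$, where $A$ is an atom $P(\bar t)$, $P\in\Sigma_P$, and $\beta$ is a body $B_1,\dots,B_k,\mathtt{not}\,C_1,\dots,\mathtt{not}\,C_m$ whose $B_i,C_j$ are atoms of $\Sigma$ or equalities between terms. We also write $\beta$ for the formula $B_1\wedge\dots\wedge B_k\wedge\neg C_1\wedge\dots\wedge\neg C_m$. Let $hd(\Pi)$ be the set of predicate symbols in heads of (choice or normal) rules of $\Pi$. \textbf{General answer sets.} Let $\tilde\Pi$ be the conjunction of the following sentences, where $\bar x$ are the variables of the rule: $\forall\bar x(\neg\neg A\wedge\beta\to A)$ for each choice rule, $\forall\bar x(\beta\to A)$ for each normal rule, $\neg\exists\bar x\,\beta$ for each constraint. For a first-order sentence $F$ (with $\neg G$ short for $G\to\bot$) and a set $\mathbf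 p$ of predicate symbols, $SM_{\mathbf p}(F)$ is the second-order sentence $F\wedge\neg\exists\mathbf u\,(\mathbf u<\mathbf p\wedge F^*(\mathbf u))$. Here $\mathbf u$ has one predicate variable $u_P$ for each $P\in\mathbf p$; $\mathbf u<\mathbf p$ says that $u_P\subseteq P$ for all $P\in\mathbf p$, with at least one inclusion strict; and $F^*$ replaces $P(\bar t)$ by $u_P(\bar t)$ for $P\in\mathbf p$, leaves other atomic formulas and $\bot$ unchanged, commutes with $\wedge,\vee,\forall,\exists$, and satisfies $(G\to H)^*=(G^*\to H^*)\wedge(G\to H)$. An interpretation is a \emph{general answer set} of $\Pi$ if it is a model of $SM_{\Sigma_P}(\tilde\Pi)$. \textbf{Proper splittings.} $P$ \emph{positively depends} on $Q$ in $\Pi$ if there is a path of non-zero length from $P$ to $Q$ in the directed graph with an edge from $P'$ to $Q'$ whenever some rule of $\Pi$ has $P'$ in its head and a non-negated $Q'$ in its body. A partition $\{\Pi_1,\dots,\Pi_n\}$ of $\Pi$ is a \emph{splitting} if each $\Pi_i$ that contains a constraint is a singleton; for each predicate $P$, all rules with $P$ in the head belong to the same $\Pi_i$; and if two predicates positively depend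 on each other, their rules belong to the same $\Pi_i$. It is \emph{proper} if, in addition, no $\Pi_i$ contains choice rules for two different predicates, no $\Pi_i$ contains both a choice rule and a normal rule, and no head predicate of a choice rule positively depends on itself. \textbf{ASP-FO modules and their models.} Each part $\Pi_i$ of a proper splitting yields one ASP-FO module $\widehat\Pi_i$. \begin{itemize} \item If $\Pi_i=\{\leftarrow\beta\}$, then $\widehat\Pi_i$ is the T-module $\forall\bar x\,\neg\beta$, with the usual models. \item If $\Pi_i$ consists of choice rules with head predicate $P$, then $\widehat\Pi_i$ is the G-module $\{\forall\bar x(\{P(\bar t)\}\leftarrow\beta)\mid (\{P(\bar t)\}\leftarrow\beta)\in\Pi_i\}$. $\mathcal M$ is a model of it if for each tuple $\bar d\in P^{\mathcal M}$ there are a rule $\{P(\bar t)\}\leftarrow\beta$ in $\Pi_i$ and values for its variables in $\mathcal M$ under which $\bar t$ has the value $\bar d$ and $\beta$ is true. \item If $\Pi_i$ consists of normal rules, then $\widehat\Pi_i$ is the D-module $(hd(\Pi_i),\{\forall\bar x(A\leftarrow\beta)\mid(A\leftarrow\beta)\in\Pi_i\})$. \end{itemize} An interpretation $\mathcal M$ is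 a model of a D-module $(D,R)$ if its restriction $N$ to the predicates in $D$ is the least one, for inclusion of all relations, among all interpretations $A$ of the predicates in $D$ over the domain of $\mathcal M$ with the following property: for each rule $\forall\bar x(P(\bar t)\leftarrow\varphi)$ of $R$ and all values of $\bar x$, if $\varphi$ holds when positive occurrences of predicates of $D$ are evaluated in $A$, negative ones in $N$, and all other symbols in $\mathcal M$, then $P(\bar t)$ holds in $A$. A model of a set of modules (an ASP-FO theory) is an interpretation that is a model of each of them. \textbf{Theorem.} Let $\Pi$ be a core ASP program over a finite vocabulary $\Sigma$ and let $\{\Pi_1,\dots,\Pi_n\}$ be a proper splitting of $\Pi$. Then an interpretation $\mathcal M$ is a general answer set of $\Pi$ if and only if $\mathcal M$ is a model of the ASP-FO theory $\{\widehat\Pi_1,\dots,\widehat\Pi_n,(Def,\{\})\}$, where $Def=\Sigma_P\setminus hd(\Pi)$ and $(Def,\{\})$ is the D-module with defined predicates $Def$ and no rules. -/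

import Mathlib

universe u v w x

namespace ASPFO



/-! ### First-order formulas

`∧`, `∨`, `→`, `∀`, `∃` are all primitive, because the operator SM is not invariant under
classical equivalence. A vocabulary is a `FirstOrder.Language`. -/

/-- Predicate symbols of a vocabulary, together with their arity. -/
abbrev PredSym (L : FirstOrder.Language.{u, v}) : Type v := Σ n : ℕ, L.Relations n

/-- First-order formulas with equality over the function symbols of `L` and the predicate symbols
(or predicate variables) `P`, with free variables indexed by `Fin k`. -/
inductive Formula (L : FirstOrder.Language.{u, v}) (P : ℕ → Type x) : ℕ → Type (max u x)
  | falsum {k : ℕ} : Formula L P k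
  | eq {k : ℕ} (s t : L.Term (Fin k)) : Formula L P k
  | atom {k n : ℕ} (p : P n) (ts : Fin n → L.Term (Fin k)) : Formula L P k
  | and {k : ℕ} (φ ψ : Formula L P k) : Formula L P k
  | or {k : ℕ} (φ ψ : Formula L P k) : Formula L P k
  | imp {k : ℕ} (φ ψ : Formula L P k) : Formula L P k
  | all {k : ℕ} (φ : Formula L P (k + 1)) : Formula L P k
  | ex {k : ℕ} (φ : Formula L P (k + 1)) : Formula L P k

/-- An interpretation over the domain `M` of the predicate symbols `P`. The pointwise order `≤` on
interpretations is the truth order. -/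
abbrev Interp (P : ℕ → Type x) (M : Type w) : Type (max x w) :=
  ∀ n : ℕ, P n → (Fin n → M) → Prop

namespace Formula

variable {L : FirstOrder.Language.{u, v}} {P : ℕ → Type x}

/-- Negation, as usual for SM, abbreviates `φ → ⊥`. -/
def neg {k : ℕ} (φ : Formula L P k) : Formula L P k := imp φ falsum

/-- The formula `⊤`. -/
def verum {k : ℕ} : Formula L P k := imp falsum falsum

/-- Conjunction of a finite list; the empty conjunction is `⊤`. -/
def conj {k : ℕ} : List (Formula L P k) → Formula L P k
  | [] => verum
  | [φ] => φ
  | φ :: ψ :: l => and φ (conj (ψ :: l))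

/-- Universal closure. -/
def alls : {k : ℕ} → Formula L P k → Formula L P 0
  | 0, φ => φ
  | _ + 1, φ => alls (all φ)

/-- Existential closure. -/
def exs : {k : ℕ} → Formula L P k → Formula L P 0
  | 0, φ => φ
  | _ + 1, φ => exs (ex φ)

/-- Renaming of predicate symbols. -/
def mapPred {Q : ℕ → Type*} (f : ∀ n, P n → Q n) : {k : ℕ} → Formula L P k → Formula L Q k
  | _, falsum => falsum
  | _, eq s t => eq s t
  | _, atom p ts => atom (f _ p) ts
  | _, and φ ψ => and (mapPred f φ) (mapPred f ψ)
  | _, or φ ψ => or (mapPred f φ) (mapPred f ψ)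
  | _, imp φ ψ => imp (mapPred f φ) (mapPred f ψ)
  | _, all φ => all (mapPred f φ)
  | _, ex φ => ex (mapPred f φ)

/-- Classical satisfaction: function symbols are interpreted by the structure on `M`, predicate
symbols by `I`, free variables by `d`. -/
def Realize {M : Type w} [L.Structure M] (I : Interp P M) :
    {k : ℕ} → Formula L P k → (Fin k → M) → Prop
  | _, falsum, _ => False
  | _, eq s t, d => s.realize d = t.realize d
  | _, atom p ts, d => I _ p (fun i => (ts i).realize d)
  | _, and φ ψ, d => Realize I φ d ∧ Realize I ψ d
  | _, or φ ψ, d => Realize I φ d ∨ Realize I ψ d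
  | _, imp φ ψ, d => Realize I φ d → Realize I ψ d
  | _, all φ, d => ∀ a : M, Realize I φ (Fin.snoc d a)
  | _, ex φ, d => ∃ a : M, Realize I φ (Fin.snoc d a)

/-- Satisfaction `(A, B) ⊨ φ` by a pair of interpretations sharing domain and function symbols:
positive occurrences of atoms are evaluated in `A`, negative ones in `B`. The clause for
`φ → ψ` is that of `¬ φ ∨ ψ`; in particular `(A, B) ⊨ ¬ φ` iff not `(B, A) ⊨ φ`. -/
def PairSat {M : Type w} [L.Structure M] :
    {k : ℕ} → Formula L P k → Interp P M → Interp P M → (Fin k → M) → Prop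
  | _, falsum, _, _, _ => False
  | _, eq s t, _, _, d => s.realize d = t.realize d
  | _, atom p ts, A, _, d => A _ p (fun i => (ts i).realize d)
  | _, and φ ψ, A, B, d => PairSat φ A B d ∧ PairSat ψ A B d
  | _, or φ ψ, A, B, d => PairSat φ A B d ∨ PairSat ψ A B d
  | _, imp φ ψ, A, B, d => ¬ PairSat φ B A d ∨ PairSat ψ A B d
  | _, all φ, A, B, d => ∀ a : M, PairSat φ A B (Fin.snoc d a)
  | _, ex φ, A, B, d => ∃ a : M, PairSat φ A B (Fin.snoc d a)

end Formula

section Semantics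

variable {L : FirstOrder.Language.{u, v}}

/-- First-order formulas of the vocabulary `L` with `k` free variables. -/
abbrev FOFormula (L : FirstOrder.Language.{u, v}) (k : ℕ) : Type (max u v) := Formula L L.Relations k

/-- First-order sentences of the vocabulary `L`. -/
abbrev FOSentence (L : FirstOrder.Language.{u, v}) : Type (max u v) := FOFormula L 0

/-- The interpretation of the predicate symbols in the structure `M`. -/
def predInterp (L : FirstOrder.Language.{u, v}) (M : Type w) [L.Structure M] : Interp L.Relations M :=
  fun _ R a => FirstOrder.Language.Structure.RelMap R a

/-- `M` is a model of the sentence `φ`. -/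
def FOSentence.Holds (φ : FOSentence L) (M : Type w) [L.Structure M] : Prop :=
  Formula.Realize (predInterp L M) φ (Fin.elim0 : Fin 0 → M)

/-- The predicate symbols that belong to the set `p`, by arity. -/
abbrev SubPred (p : Set (PredSym L)) (n : ℕ) : Type v :=
  {R : L.Relations n // (⟨n, R⟩ : PredSym L) ∈ p}

/-- The restriction of an interpretation to the predicate symbols in `p`. -/
def restrict {M : Type w} (p : Set (PredSym L)) (I : Interp L.Relations M) :
    Interp (SubPred p) M :=
  fun n R => I n R.1

open Classical in
/-- The composition `I ∘ A`: symbols in `p` are interpreted by `A`, all others by `I`. -/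
noncomputable def overlay {M : Type w} {p : Set (PredSym L)} (I : Interp L.Relations M)
    (A : Interp (SubPred p) M) : Interp L.Relations M :=
  fun n R => if h : (⟨n, R⟩ : PredSym L) ∈ p then A n ⟨R, h⟩ else I n R

/-! ### The operator SM of Ferraris, Lee and Lifschitz -/

/-- The predicate symbols of `L` together with one fresh predicate variable `u_R` for each `R`
in `p`. -/
abbrev WithVars (p : Set (PredSym L)) (n : ℕ) : Type v := L.Relations n ⊕ SubPred p n

open Classical in
/-- The transformation `F ↦ F*(u)`. -/
noncomputable def star (p : Set (PredSym L)) :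
    {k : ℕ} → FOFormula L k → Formula L (WithVars p) k
  | _, .falsum => .falsum
  | _, .eq s t => .eq s t
  | _, .atom (n := n) R ts =>
      if h : (⟨n, R⟩ : PredSym L) ∈ p then .atom (P := WithVars p) (Sum.inr ⟨R, h⟩) ts
      else .atom (P := WithVars p) (Sum.inl R) ts
  | _, .and φ ψ => .and (star p φ) (star p ψ)
  | _, .or φ ψ => .or (star p φ) (star p ψ)
  | _, .imp φ ψ =>
      .and (.imp (star p φ) (star p ψ))
        (.imp (φ.mapPred (Q := WithVars p) fun _ => Sum.inl)
          (ψ.mapPred (Q := WithVars p) fun _ => Sum.inl))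
  | _, .all φ => .all (star p φ)
  | _, .ex φ => .ex (star p φ)

/-- `M` is a model of the second-order sentence `SM_p(F) = F ∧ ¬ ∃ u (u < p ∧ F*(u))`. Here
`u < p` is `u ≤ p ∧ ¬ (p ≤ u)` for the pointwise order. -/
def ModelsSM (p : Set (PredSym L)) (F : FOSentence L) (M : Type w) [L.Structure M] : Prop :=
  F.Holds M ∧
    ¬ ∃ U : Interp (SubPred p) M, U < restrict p (predInterp L M) ∧
      (star p F).Realize (fun n => Sum.elim (predInterp L M n) (U n)) (Fin.elim0 : Fin 0 → M)

/-! ### Core ASP programs -/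

/-- An atom `P(t₁, …, tₙ)` with variables in `Fin k`. -/
structure PredAtom (L : FirstOrder.Language.{u, v}) (k : ℕ) where
  arity : ℕ
  rel : L.Relations arity
  args : Fin arity → L.Term (Fin k)

/-- The predicate symbol of an atom. -/
def PredAtom.sym {k : ℕ} (A : PredAtom L k) : PredSym L := ⟨A.arity, A.rel⟩

/-- The atom as a formula. -/
def PredAtom.toFormula {k : ℕ} (A : PredAtom L k) : FOFormula L k := .atom A.rel A.args

/-- Atoms in rule bodies: predicate atoms and equalities. -/
inductive BodyAtom (L : FirstOrder.Language.{u, v}) (k : ℕ) : Type (max u v)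
  | pred (A : PredAtom L k) : BodyAtom L k
  | eq (s t : L.Term (Fin k)) : BodyAtom L k

/-- The body atom as a formula. -/
def BodyAtom.toFormula {k : ℕ} : BodyAtom L k → FOFormula L k
  | .pred A => A.toFormula
  | .eq s t => .eq s t

/-- A rule body `B₁, …, Bₙ, not C₁, …, not Cₘ`. -/
structure Body (L : FirstOrder.Language.{u, v}) (k : ℕ) where
  pos : List (BodyAtom L k)
  neg : List (BodyAtom L k)

/-- The literals of a body, with `not` read as negation. -/
def Body.literals {k : ℕ} (B : Body L k) : List (FOFormula L k) :=
  B.pos.map BodyAtom.toFormula ++ B.neg.map fun C => C.toFormula.neg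

/-- The body as a formula: `B₁ ∧ … ∧ Bₙ ∧ ¬ C₁ ∧ … ∧ ¬ Cₘ`. -/
def Body.toFormula {k : ℕ} (B : Body L k) : FOFormula L k := .conj B.literals

/-- Rules of core ASP, with variables in `Fin k`: choice rules `{A} ← body`, normal rules
`A ← body` and constraints `← body`. -/
inductive CoreRule (L : FirstOrder.Language.{u, v}) : Type (max u v)
  | choice {k : ℕ} (A : PredAtom L k) (B : Body L k) : CoreRule L
  | normal {k : ℕ} (A : PredAtom L k) (B : Body L k) : CoreRule L
  | constraint {k : ℕ} (B : Body L k) : CoreRule L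

namespace CoreRule

/-- The rule is a choice rule with head predicate `P`. -/
def IsChoiceFor : CoreRule L → PredSym L → Prop
  | choice A _, P => A.sym = P
  | normal _ _, _ => False
  | constraint _, _ => False

/-- The rule is a normal rule with head predicate `P`. -/
def IsNormalFor : CoreRule L → PredSym L → Prop
  | choice _ _, _ => False
  | normal A _, P => A.sym = P
  | constraint _, _ => False

/-- The rule is a constraint. -/
def IsConstraint : CoreRule L → Prop
  | choice _ _ => False
  | normal _ _ => False
  | constraint _ => True

/-- `P` is the predicate in the head of the rule. -/
def HasHead (r : CoreRule L) (P : PredSym L) : Prop := r.IsChoiceFor P ∨ r.IsNormalFor P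

/-- `Q` occurs non-negated in the body of the rule. -/
def HasPosBody : CoreRule L → PredSym L → Prop
  | choice _ B, Q => ∃ A : PredAtom L _, BodyAtom.pred A ∈ B.pos ∧ A.sym = Q
  | normal _ B, Q => ∃ A : PredAtom L _, BodyAtom.pred A ∈ B.pos ∧ A.sym = Q
  | constraint B, Q => ∃ A : PredAtom L _, BodyAtom.pred A ∈ B.pos ∧ A.sym = Q

/-- The first-order sentence that represents a rule under the semantics of Ferraris, Lee and
Lifschitz. -/
def tilde : CoreRule L → FOSentence L
  | choice A B =>
      .alls (.imp (.conj (A.toFormula.neg.neg :: B.literals)) A.toFormula)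
  | normal A B => .alls (.imp B.toFormula A.toFormula)
  | constraint B => .neg (.exs B.toFormula)

end CoreRule

/-- A core ASP program: a finite set of rules. -/
abbrev CoreProgram (L : FirstOrder.Language.{u, v}) : Type (max u v) := Finset (CoreRule L)

namespace CoreProgram

/-- The predicates in the heads of the rules of the program. -/
def hd (Pr : CoreProgram L) : Set (PredSym L) := {P | ∃ r ∈ Pr, r.HasHead P}

/-- The conjunction of the sentences that represent the rules. -/
noncomputable def tilde (Pr : CoreProgram L) : FOSentence L :=
  .conj (Pr.toList.map CoreRule.tilde)

/-- `M` is a general answer set: a model of `SM` with respect to all predicate symbols. -/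
def IsGeneralAnswerSet (Pr : CoreProgram L) (M : Type w) [L.Structure M] : Prop :=
  ModelsSM Set.univ Pr.tilde M

/-- Edges of the positive predicate dependency graph. -/
def PosEdge (Pr : CoreProgram L) (P Q : PredSym L) : Prop :=
  ∃ r ∈ Pr, r.HasHead P ∧ r.HasPosBody Q

/-- `P` positively depends on `Q`: there is a path of non-zero length from `P` to `Q`. -/
def PosDepends (Pr : CoreProgram L) : PredSym L → PredSym L → Prop :=
  Relation.TransGen Pr.PosEdge

/-- `parts` is a splitting of the program. -/
structure IsSplitting (Pr : CoreProgram L) {n : ℕ} (parts : Fin n → CoreProgram L) : Prop where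
  nonempty : ∀ i, (parts i).Nonempty
  disjoint : ∀ i j, i ≠ j → Disjoint (parts i) (parts j)
  cover : ∀ r, r ∈ Pr ↔ ∃ i, r ∈ parts i
  constraint_singleton : ∀ i, ∀ r ∈ parts i, r.IsConstraint → parts i = {r}
  same_head : ∀ P i j, ∀ r ∈ parts i, ∀ s ∈ parts j, r.HasHead P → s.HasHead P → i = j
  mutual_dep : ∀ P Q, Pr.PosDepends P Q → Pr.PosDepends Q P →
    ∀ i j, ∀ r ∈ parts i, ∀ s ∈ parts j, r.HasHead P → s.HasHead Q → i = j

/-- `parts` is a proper splitting of the program. -/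
structure IsProperSplitting (Pr : CoreProgram L) {n : ℕ} (parts : Fin n → CoreProgram L) : Prop
    extends IsSplitting Pr parts where
  choice_unique : ∀ i P Q, ∀ r ∈ parts i, ∀ s ∈ parts i,
    r.IsChoiceFor P → s.IsChoiceFor Q → P = Q
  not_mixed : ∀ i P Q, ∀ r ∈ parts i, ∀ s ∈ parts i, ¬ (r.IsChoiceFor P ∧ s.IsNormalFor Q)
  choice_not_recursive : ∀ P, ∀ r ∈ Pr, r.IsChoiceFor P → ¬ Pr.PosDepends P P

end CoreProgram

/-! ### ASP-FO -/

/-- The data common to a choice rule `∀ x̄ ({P(t̄)} ← φ)` and a define rule `∀ x̄ (P(t̄) ← φ)`, where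
`φ` is a first-order formula. -/
structure FORule (L : FirstOrder.Language.{u, v}) where
  vars : ℕ
  head : PredAtom L vars
  body : FOFormula L vars

/-- A G-module: a finite set of choice rules with the same head predicate. -/
structure GModule (L : FirstOrder.Language.{u, v}) where
  headPred : PredSym L
  rules : Set (FORule L)
  finite : rules.Finite
  head_eq : ∀ ρ ∈ rules, ρ.head.sym = headPred

/-- A D-module `⟨Def, Π⟩`: a finite set of defined predicates and a finite set of define rules whose
head predicates are defined predicates. -/
structure DModule (L : FirstOrder.Language.{u, v}) where
  defined : Set (PredSym L)
  defined_finite : defined.Finite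
  rules : Set (FORule L)
  rules_finite : rules.Finite
  head_mem : ∀ ρ ∈ rules, ρ.head.sym ∈ defined

/-- `M` is a model of a G-module: each true atom of the head predicate is an instance of the head of
a choice rule whose body holds under the same instantiation. -/
def GModule.Holds (G : GModule L) (M : Type w) [L.Structure M] : Prop :=
  ∀ d : Fin G.headPred.1 → M, predInterp L M G.headPred.1 G.headPred.2 d →
    ∃ ρ ∈ G.rules, ∃ e : Fin ρ.vars → M,
      (⟨ρ.head.arity, fun i => (ρ.head.args i).realize e⟩ : Σ n, Fin n → M) =
          ⟨G.headPred.1, d⟩ ∧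
        ρ.body.Realize (predInterp L M) e

/-- The pair `(A, B)` satisfies a define rule. -/
def FORule.PairSat {M : Type w} [L.Structure M] (ρ : FORule L) (A B : Interp L.Relations M) :
    Prop :=
  ∀ d : Fin ρ.vars → M, ρ.body.PairSat A B d →
    A ρ.head.arity ρ.head.rel (fun i => (ρ.head.args i).realize d)

/-- `N` is a stable model of `D` relative to `I`: the least among the interpretations `A` of the
defined predicates such that `(I ∘ A, I ∘ N)` satisfies all rules. Only the values of `I` on
parameters matter. -/
def DModule.IsStableModel {M : Type w} [L.Structure M] (D : DModule L)
    (I : Interp L.Relations M) (N : Interp (SubPred D.defined) M) : Prop :=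
  IsLeast {A : Interp (SubPred D.defined) M |
    ∀ ρ ∈ D.rules, ρ.PairSat (overlay I A) (overlay I N)} N

/-- `M` is a model of a D-module. -/
def DModule.Holds (D : DModule L) (M : Type w) [L.Structure M] : Prop :=
  D.IsStableModel (predInterp L M) (restrict D.defined (predInterp L M))

/-- Modules of ASP-FO; a T-module is a first-order sentence. -/
inductive ASPModule (L : FirstOrder.Language.{u, v}) : Type (max u v)
  | g (G : GModule L) : ASPModule L
  | d (D : DModule L) : ASPModule L
  | t (φ : FOSentence L) : ASPModule L

/-- `M` is a model of a module. -/
def ASPModule.Holds (m : ASPModule L) (M : Type w) [L.Structure M] : Prop :=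
  match m with
  | .g G => G.Holds M
  | .d D => D.Holds M
  | .t φ => φ.Holds M

/-- An ASP-FO theory: a finite set of modules. -/
structure ASPTheory (L : FirstOrder.Language.{u, v}) where
  modules : Set (ASPModule L)
  finite : modules.Finite

/-- `M` is a model of an ASP-FO theory. -/
def ASPTheory.Holds (T : ASPTheory L) (M : Type w) [L.Structure M] : Prop :=
  ∀ m ∈ T.modules, m.Holds M

end Semantics

/-! ### From core ASP to ASP-FO -/

section Translation

variable {L : FirstOrder.Language.{u, v}}

/-- The ASP-FO choice rule of a core ASP choice rule. -/
def CoreRule.hatChoice : CoreRule L → Option (FORule L)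
  | .choice A B => some ⟨_, A, B.toFormula⟩
  | _ => none

/-- The define rule of a normal rule. -/
def CoreRule.hatNormal : CoreRule L → Option (FORule L)
  | .normal A B => some ⟨_, A, B.toFormula⟩
  | _ => none

/-- The T-module `∀ x̄ ¬ body` of a constraint. -/
def CoreRule.hatConstraint : CoreRule L → Option (FOSentence L)
  | .constraint B => some (.alls B.toFormula.neg)
  | _ => none

lemma finite_filterMap {α β : Type*} (s : Finset α) (f : α → Option β) :
    {b | ∃ a ∈ s, f a = some b}.Finite := by
  have h := (s.finite_toSet.image f).preimage (Option.some_injective β).injOn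
  refine h.subset ?_
  rintro b ⟨a, ha, hb⟩
  exact ⟨a, ha, hb⟩

namespace CoreProgram

/-- The G-module of all choice rules of the program with head predicate `P`. -/
def gModule (Pr : CoreProgram L) (P : PredSym L) : GModule L where
  headPred := P
  rules := {ρ | (∃ r ∈ Pr, r.hatChoice = some ρ) ∧ ρ.head.sym = P}
  finite := (finite_filterMap Pr CoreRule.hatChoice).subset fun _ h => h.1
  head_eq := fun _ h => h.2

/-- The D-module `⟨hd(Π), Π⟩` of all normal rules of the program. -/
def dModule [Finite (PredSym L)] (Pr : CoreProgram L) : DModule L where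
  defined := {P | ∃ r ∈ Pr, r.IsNormalFor P}
  defined_finite := Set.toFinite _
  rules := {ρ | ∃ r ∈ Pr, r.hatNormal = some ρ}
  rules_finite := finite_filterMap Pr CoreRule.hatNormal
  head_mem := by
    rintro ρ ⟨r, hr, h⟩
    cases r with
    | normal A B =>
      obtain rfl : _ = ρ := Option.some.inj h
      exact ⟨_, hr, rfl⟩
    | choice A B => exact absurd h (by simp [CoreRule.hatNormal])
    | constraint B => exact absurd h (by simp [CoreRule.hatNormal])

/-- The rewriting of a program in ASP-FO: choice rules are grouped by head predicate into G-modules,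
normal rules form one D-module (if there are any), and each constraint is a T-module. Each part of
a proper splitting has rules of only one of these kinds, and yields exactly one module. -/
def hat [Finite (PredSym L)] (Pr : CoreProgram L) : Set (ASPModule L) :=
  {m | ∃ P, (∃ r ∈ Pr, r.IsChoiceFor P) ∧ m = .g (Pr.gModule P)} ∪
  {m | (∃ r ∈ Pr, ∃ P, r.IsNormalFor P) ∧ m = .d Pr.dModule} ∪
  {m | ∃ φ, (∃ r ∈ Pr, r.hatConstraint = some φ) ∧ m = .t φ}

lemma hat_finite [Finite (PredSym L)] (Pr : CoreProgram L) : Pr.hat.Finite := by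
  refine Set.Finite.union (Set.Finite.union ?_ ?_) ?_
  · refine (Set.finite_range fun P => ASPModule.g (Pr.gModule P)).subset ?_
    rintro m ⟨P, -, rfl⟩
    exact ⟨P, rfl⟩
  · exact (Set.finite_singleton (ASPModule.d Pr.dModule)).subset fun m h => h.2
  · refine ((finite_filterMap Pr CoreRule.hatConstraint).image ASPModule.t).subset ?_
    rintro m ⟨φ, h, rfl⟩
    exact ⟨φ, h, rfl⟩

/-- The D-module `(Def, {})`, where `Def` is the set of the predicate symbols of the vocabulary that
are not in the head of any rule of the program. -/
def emptyDefModule [Finite (PredSym L)] (Pr : CoreProgram L) : DModule L where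
  defined := Pr.hdᶜ
  defined_finite := Set.toFinite _
  rules := ∅
  rules_finite := Set.finite_empty
  head_mem := fun _ h => absurd h (Set.notMem_empty _)

/-- The ASP-FO theory `{Π̂₁, …, Π̂ₙ, (Def, {})}`. -/
def splitTheory [Finite (PredSym L)] (Pr : CoreProgram L) {n : ℕ}
    (parts : Fin n → CoreProgram L) : ASPTheory L where
  modules := (⋃ i, (parts i).hat) ∪ {ASPModule.d Pr.emptyDefModule}
  finite := (Set.finite_iUnion fun i => (parts i).hat_finite).union (Set.finite_singleton _)

end CoreProgram

end Translation

end ASPFO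

/-! Let `I` be the predicate interpretation of `M`. Both semantics of a rule reduce to closure under
its reduct relative to `I`: negated literals and the double negation `¬¬A` of a choice rule are
evaluated in `I`, everything else in a candidate `V`. By `isGeneralAnswerSet_iff`, `M` is a general
answer set iff `I` respects the constraints, is closed under its own reduct, and lies below every
closed `V ≤ I`. `splitTheory_holds_iff` separates the theory into constraints, G-modules, D-modules
and the empty definition.

From answer set to theory, each module follows by testing minimality on one `V`: delete one
unsupported choice atom, intersect `I` with a competitor of a D-module, or delete all atoms of
non-head predicates.

Conversely (`le_of_reductClosed`), let `V ≤ I` be closed. Induction along strict positive dependency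
shows `I ≤ V` one predicate at a time. A choice predicate has only strictly lower predicates in its
positive bodies, so its G-module support transfers to `V`. For a normal predicate, least-ness of its
D-module is applied to a competitor equal to `V` on the mutual-dependency class of that predicate
and to `I` elsewhere. The dependency conditions on the splitting enter only here. -/

namespace ASPFO

/-! ### Satisfaction of conjunctions, closures and renamed formulas -/

namespace Formula

variable {L : FirstOrder.Language.{u, v}} {P : ℕ → Type x} {M : Type w} [L.Structure M]

lemma realize_conj (I : Interp P M) {k : ℕ} (l : List (Formula L P k)) (e : Fin k → M) :
    (conj l).Realize I e ↔ ∀ φ ∈ l, φ.Realize I e := by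
  induction l with
  | nil => simp [conj, verum, Realize]
  | cons φ l ih =>
    cases l with
    | nil => simp [conj]
    | cons ψ l =>
      rw [List.forall_mem_cons, ← ih]
      exact Iff.rfl

lemma pairSat_conj (A B : Interp P M) {k : ℕ} (l : List (Formula L P k)) (e : Fin k → M) :
    (conj l).PairSat A B e ↔ ∀ φ ∈ l, φ.PairSat A B e := by
  induction l with
  | nil => simp [conj, verum, PairSat]
  | cons φ l ih =>
    cases l with
    | nil => simp [conj]
    | cons ψ l =>
      rw [List.forall_mem_cons, ← ih]
      exact Iff.rfl

lemma realize_alls (I : Interp P M) {k : ℕ} (φ : Formula L P k) :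
    φ.alls.Realize I (Fin.elim0 : Fin 0 → M) ↔ ∀ e, φ.Realize I e := by
  induction k with
  | zero =>
    refine ⟨fun h e => ?_, fun h => h _⟩
    rw [Subsingleton.elim e Fin.elim0]
    exact h
  | succ k ih =>
    refine (ih (all φ)).trans ⟨fun h e => ?_, fun h e a => h _⟩
    rw [← Fin.snoc_init_self e]
    exact h _ _

lemma realize_exs (I : Interp P M) {k : ℕ} (φ : Formula L P k) :
    φ.exs.Realize I (Fin.elim0 : Fin 0 → M) ↔ ∃ e, φ.Realize I e := by
  induction k with
  | zero =>
    refine ⟨fun h => ⟨_, h⟩, ?_⟩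
    rintro ⟨e, h⟩
    rw [Subsingleton.elim e Fin.elim0] at h
    exact h
  | succ k ih =>
    refine (ih (ex φ)).trans ⟨fun ⟨e, a, h⟩ => ⟨_, h⟩, fun ⟨e, h⟩ => ⟨Fin.init e, e (Fin.last k), ?_⟩⟩
    rw [Fin.snoc_init_self]
    exact h

lemma realize_mapPred {Q : ℕ → Type*} (f : ∀ n, P n → Q n) (J : Interp Q M) {k : ℕ}
    (φ : Formula L P k) (e : Fin k → M) :
    (φ.mapPred f).Realize J e ↔ φ.Realize (fun n R => J n (f n R)) e := by
  induction φ with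
  | falsum => exact Iff.rfl
  | eq s t => exact Iff.rfl
  | atom p ts => exact Iff.rfl
  | and φ ψ h₁ h₂ => exact and_congr (h₁ e) (h₂ e)
  | or φ ψ h₁ h₂ => exact or_congr (h₁ e) (h₂ e)
  | imp φ ψ h₁ h₂ => exact imp_congr (h₁ e) (h₂ e)
  | all φ h => exact forall_congr' fun a => h _
  | ex φ h => exact exists_congr fun a => h _

end Formula

/-! ### Satisfaction of the starred formula -/

section Star

variable {L : FirstOrder.Language.{u, v}} {M : Type w} {p : Set (PredSym L)}

lemma overlay_of_mem (I : Interp L.Relations M) (A : Interp (SubPred p) M) {n : ℕ}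
    {R : L.Relations n} (h : (⟨n, R⟩ : PredSym L) ∈ p) : overlay I A n R = A n ⟨R, h⟩ :=
  dif_pos h

lemma overlay_of_notMem (I : Interp L.Relations M) (A : Interp (SubPred p) M) {n : ℕ}
    {R : L.Relations n} (h : (⟨n, R⟩ : PredSym L) ∉ p) : overlay I A n R = I n R :=
  dif_neg h

lemma overlay_restrict (I : Interp L.Relations M) : overlay I (restrict p I) = I := by
  funext n R
  by_cases h : (⟨n, R⟩ : PredSym L) ∈ p
  · rw [overlay_of_mem _ _ h]; rfl
  · rw [overlay_of_notMem _ _ h]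

lemma overlay_le {I : Interp L.Relations M} {A : Interp (SubPred p) M}
    (hA : A ≤ restrict p I) : overlay I A ≤ I := by
  intro n R
  by_cases h : (⟨n, R⟩ : PredSym L) ∈ p
  · rw [overlay_of_mem _ _ h]; exact hA n ⟨R, h⟩
  · rw [overlay_of_notMem _ _ h]

variable [L.Structure M]

/-- The truth of `F*(U)`, where the predicate symbols are interpreted by `I`. -/
def StarSat (I : Interp L.Relations M) (U : Interp (SubPred p) M) {k : ℕ} (φ : FOFormula L k)
    (e : Fin k → M) : Prop :=
  (star p φ).Realize (fun n => Sum.elim (I n) (U n)) e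

variable {I : Interp L.Relations M} {U : Interp (SubPred p) M} {k : ℕ}

lemma starSat_atom {n : ℕ} (R : L.Relations n) (ts : Fin n → L.Term (Fin k)) (e : Fin k → M) :
    StarSat I U (.atom R ts) e ↔ overlay I U n R fun i => (ts i).realize e := by
  unfold StarSat
  by_cases h : (⟨n, R⟩ : PredSym L) ∈ p
  · rw [star, dif_pos h, overlay_of_mem _ _ h]; exact Iff.rfl
  · rw [star, dif_neg h, overlay_of_notMem _ _ h]; exact Iff.rfl

lemma starSat_imp (φ ψ : FOFormula L k) (e : Fin k → M) :
    StarSat I U (.imp φ ψ) e ↔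
      (StarSat I U φ e → StarSat I U ψ e) ∧ (Formula.imp φ ψ).Realize I e := by
  unfold StarSat
  rw [star]
  exact and_congr Iff.rfl
    (imp_congr (Formula.realize_mapPred _ _ φ e) (Formula.realize_mapPred _ _ ψ e))

lemma starSat_neg (φ : FOFormula L k) (e : Fin k → M) :
    StarSat I U φ.neg e ↔ ¬ StarSat I U φ e ∧ ¬ φ.Realize I e := by
  unfold Formula.neg
  rw [starSat_imp]
  exact Iff.rfl

lemma starSat_conj (l : List (FOFormula L k)) (e : Fin k → M) :
    StarSat I U (.conj l) e ↔ ∀ φ ∈ l, StarSat I U φ e := by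
  induction l with
  | nil => simp [Formula.conj, Formula.verum, starSat_imp, Formula.Realize]
  | cons φ l ih =>
    cases l with
    | nil => simp [Formula.conj]
    | cons ψ l =>
      rw [List.forall_mem_cons, ← ih]
      exact Iff.rfl

lemma starSat_alls (φ : FOFormula L k) :
    StarSat I U φ.alls Fin.elim0 ↔ ∀ e, StarSat I U φ e := by
  induction k with
  | zero =>
    refine ⟨fun h e => ?_, fun h => h _⟩
    rw [Subsingleton.elim e Fin.elim0]
    exact h
  | succ k ih =>
    refine (ih (.all φ)).trans ⟨fun h e => ?_, fun h e a => h _⟩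
    rw [← Fin.snoc_init_self e]
    exact h _ _

/-- Persistence. The implication case needs no induction hypothesis, because `F*` keeps the original
implication as a conjunct; this is why arbitrary nesting causes no polarity problem. -/
lemma StarSat.realize (hU : U ≤ restrict p I) {φ : FOFormula L k} {e : Fin k → M}
    (h : StarSat I U φ e) : φ.Realize I e := by
  induction φ with
  | falsum => exact h
  | eq s t => exact h
  | atom R ts => exact overlay_le hU _ _ _ ((starSat_atom R ts e).1 h)
  | and φ ψ h₁ h₂ => exact ⟨h₁ h.1, h₂ h.2⟩
  | or φ ψ h₁ h₂ => exact h.imp h₁ h₂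
  | imp φ ψ h₁ h₂ => exact ((starSat_imp φ ψ e).1 h).2
  | all φ ih => exact fun a => ih (h a)
  | ex φ ih => exact let ⟨a, ha⟩ := h; ⟨a, ih ha⟩

/-- By persistence a starred negation is insensitive to `U`. This is what makes negated literals
part of a reduct fixed by `I`. -/
lemma starSat_neg_iff (hU : U ≤ restrict p I) (φ : FOFormula L k) (e : Fin k → M) :
    StarSat I U φ.neg e ↔ ¬ φ.Realize I e := by
  rw [starSat_neg]
  exact ⟨fun h => h.2, fun h => ⟨fun h' => h (h'.realize hU), h⟩⟩

end Star

/-! ### Reducts, and general answer sets as minimal closed interpretations -/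

section Reduct

variable {L : FirstOrder.Language.{u, v}} {M : Type w} [L.Structure M] {k : ℕ}

/-- The positive part of the body is true in `V` and the negative part in `I`. -/
def Body.Sat (B : Body L k) (V I : Interp L.Relations M) (e : Fin k → M) : Prop :=
  (∀ b ∈ B.pos, b.toFormula.Realize V e) ∧ ∀ c ∈ B.neg, ¬ c.toFormula.Realize I e

/-- The atom is true in `V`. -/
def PredAtom.Sat (A : PredAtom L k) (V : Interp L.Relations M) (e : Fin k → M) : Prop :=
  V A.arity A.rel fun i => (A.args i).realize e

/-- Comparison is required only on the atoms of the positive body, since the induction over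
dependencies knows nothing about other predicates. -/
lemma Body.Sat.imp {B : Body L k} {V W I : Interp L.Relations M} {e : Fin k → M}
    (h : B.Sat V I e)
    (hVW : ∀ A : PredAtom L k, .pred A ∈ B.pos → A.Sat V e → A.Sat W e) : B.Sat W I e := by
  refine ⟨fun b hb => ?_, h.2⟩
  have hV := h.1 b hb
  cases b with
  | pred A => exact hVW A hb hV
  | eq s t => exact hV

lemma Body.Sat.mono {B : Body L k} {V W I : Interp L.Relations M} {e : Fin k → M}
    (h : B.Sat V I e) (hVW : V ≤ W) : B.Sat W I e :=
  h.imp fun _ _ => hVW _ _ _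

lemma Body.forall_literals {B : Body L k} {q : FOFormula L k → Prop} :
    (∀ φ ∈ B.literals, q φ) ↔
      (∀ b ∈ B.pos, q b.toFormula) ∧ ∀ c ∈ B.neg, q c.toFormula.neg := by
  simp only [Body.literals, List.mem_append, List.mem_map]
  constructor
  · exact fun h => ⟨fun b hb => h _ (.inl ⟨b, hb, rfl⟩), fun c hc => h _ (.inr ⟨c, hc, rfl⟩)⟩
  · rintro ⟨h₁, h₂⟩ φ (⟨b, hb, rfl⟩ | ⟨c, hc, rfl⟩)
    exacts [h₁ b hb, h₂ c hc]

lemma Body.realize_literals (B : Body L k) (I : Interp L.Relations M) (e : Fin k → M) :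
    (∀ φ ∈ B.literals, φ.Realize I e) ↔ B.Sat I I e :=
  Body.forall_literals

lemma Body.realize_toFormula (B : Body L k) (I : Interp L.Relations M) (e : Fin k → M) :
    B.toFormula.Realize I e ↔ B.Sat I I e :=
  (Formula.realize_conj _ _ _).trans (B.realize_literals I e)

lemma BodyAtom.pairSat_toFormula (b : BodyAtom L k) (V I : Interp L.Relations M) (e : Fin k → M) :
    b.toFormula.PairSat V I e ↔ b.toFormula.Realize V e := by
  cases b <;> exact Iff.rfl

/-- The meeting point of the two semantics: each `C` lies under exactly one negation, so the pair
`(V, I)` evaluates a core body just as the reduct does. -/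
lemma Body.pairSat_toFormula (B : Body L k) (V I : Interp L.Relations M) (e : Fin k → M) :
    B.toFormula.PairSat V I e ↔ B.Sat V I e := by
  refine (Formula.pairSat_conj _ _ _ _).trans (Body.forall_literals.trans ?_)
  simp only [BodyAtom.pairSat_toFormula, Formula.neg, Formula.PairSat, or_false, Body.Sat]

section

variable {p : Set (PredSym L)} {I : Interp L.Relations M} {U : Interp (SubPred p) M}

lemma BodyAtom.starSat_toFormula (b : BodyAtom L k) (e : Fin k → M) :
    StarSat I U b.toFormula e ↔ b.toFormula.Realize (overlay I U) e := by
  cases b with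
  | pred A => exact starSat_atom _ _ _
  | eq s t => exact Iff.rfl

lemma Body.starSat_literals (hU : U ≤ restrict p I) (B : Body L k) (e : Fin k → M) :
    (∀ φ ∈ B.literals, StarSat I U φ e) ↔ B.Sat (overlay I U) I e := by
  rw [Body.forall_literals]
  simp only [BodyAtom.starSat_toFormula, starSat_neg_iff hU, Body.Sat]

end

namespace CoreRule

/-- `V` is closed under the reduct of the rule with respect to `I`. -/
def ReductClosed (I V : Interp L.Relations M) : CoreRule L → Prop
  | choice A B => ∀ e, A.Sat I e → B.Sat V I e → A.Sat V e
  | normal A B => ∀ e, B.Sat V I e → A.Sat V e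
  | constraint _ => True

/-- If the rule is a constraint, then no instance of its body is true in `I`. -/
def ConstraintHolds (I : Interp L.Relations M) : CoreRule L → Prop
  | choice _ _ => True
  | normal _ _ => True
  | constraint B => ∀ e, ¬ B.Sat I I e

lemma realize_tilde (r : CoreRule L) (I : Interp L.Relations M) :
    r.tilde.Realize I (Fin.elim0 : Fin 0 → M) ↔ r.ConstraintHolds I ∧ r.ReductClosed I I := by
  cases r with
  | choice A B =>
    refine iff_of_true ?_ ⟨trivial, fun e h _ => h⟩
    refine (Formula.realize_alls _ _).2 fun e h => ?_
    exact not_not.1 (((Formula.realize_conj _ _ _).1 h) _ List.mem_cons_self)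
  | normal A B =>
    refine (Formula.realize_alls _ _).trans ?_
    simp only [ConstraintHolds, true_and, ReductClosed, ← Body.realize_toFormula]
    exact Iff.rfl
  | constraint B =>
    refine (not_congr (Formula.realize_exs _ _)).trans ?_
    simp only [ConstraintHolds, ReductClosed, and_true, not_exists, Body.realize_toFormula]

/-- Classical truth of the rule absorbs the second conjunct of the starred implication. In a choice
rule `¬¬A` is read in `I`, so an instance acts as a normal rule if its head is true in `I` and is
void otherwise. -/
lemma starSat_tilde {p : Set (PredSym L)} {I : Interp L.Relations M}
    {U : Interp (SubPred p) M} (hU : U ≤ restrict p I) (r : CoreRule L)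
    (hr : r.tilde.Realize I (Fin.elim0 : Fin 0 → M)) :
    StarSat I U r.tilde Fin.elim0 ↔ r.ReductClosed I (overlay I U) := by
  cases r with
  | choice A B =>
    refine (starSat_alls _).trans (forall_congr' fun e => ?_)
    have hr' := (Formula.realize_alls _ _).1 hr e
    have hA : StarSat I U A.toFormula.neg.neg e ↔ A.Sat I e :=
      (starSat_neg_iff hU _ e).trans not_not
    rw [starSat_imp, and_iff_left hr', starSat_conj, List.forall_mem_cons, hA,
      Body.starSat_literals hU, and_imp]
    exact imp_congr_right fun _ => imp_congr_right fun _ => starSat_atom _ _ _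
  | normal A B =>
    refine (starSat_alls _).trans (forall_congr' fun e => ?_)
    have hr' := (Formula.realize_alls _ _).1 hr e
    rw [starSat_imp, and_iff_left hr', Body.toFormula, starSat_conj, Body.starSat_literals hU]
    exact imp_congr_right fun _ => starSat_atom _ _ _
  | constraint B =>
    exact iff_of_true ((starSat_neg_iff hU _ _).2 hr) trivial

end CoreRule

lemma CoreProgram.isGeneralAnswerSet_iff (Pr : CoreProgram L) :
    Pr.IsGeneralAnswerSet M ↔
      (∀ r ∈ Pr, r.ConstraintHolds (predInterp L M)) ∧
      (∀ r ∈ Pr, r.ReductClosed (predInterp L M) (predInterp L M)) ∧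
      ∀ V ≤ predInterp L M, (∀ r ∈ Pr, r.ReductClosed (predInterp L M) V) →
        predInterp L M ≤ V := by
  set I := predInterp L M with hI
  have hholds : Pr.tilde.Holds M ↔ ∀ r ∈ Pr, r.tilde.Realize I (Fin.elim0 : Fin 0 → M) := by
    refine (Formula.realize_conj _ _ _).trans ?_
    simp [hI]
  have hstar (U : Interp (SubPred (Set.univ : Set (PredSym L))) M) :
      StarSat I U Pr.tilde Fin.elim0 ↔ ∀ r ∈ Pr, StarSat I U r.tilde Fin.elim0 := by
    refine (starSat_conj _ _).trans ?_
    simp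
  have key (h : ∀ r ∈ Pr, r.tilde.Realize I (Fin.elim0 : Fin 0 → M)) :
      (¬ ∃ U : Interp (SubPred Set.univ) M, U < restrict Set.univ I ∧
        StarSat I U Pr.tilde Fin.elim0) ↔
      ∀ V ≤ I, (∀ r ∈ Pr, r.ReductClosed I V) → I ≤ V := by
    constructor
    · intro hmin V hV hcl
      by_contra hIV
      have hle : restrict Set.univ V ≤ restrict Set.univ I := fun n R => hV n R.1
      refine hmin ⟨restrict Set.univ V, lt_of_le_not_ge hle fun h' => hIV fun n R =>
        h' n ⟨R, trivial⟩, (hstar _).2 fun r hr => ?_⟩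
      rw [CoreRule.starSat_tilde hle r (h r hr)]
      -- Every predicate lies in `Set.univ`, so the overlay of the restriction of `V` is `V` itself.
      convert hcl r hr using 1
      funext n R
      rw [overlay_of_mem _ _ (Set.mem_univ _)]
      rfl
    · rintro hmin ⟨U, hlt, hU⟩
      refine hlt.not_ge fun n R => ?_
      have := hmin (overlay I U) (overlay_le hlt.le) fun r hr =>
        (CoreRule.starSat_tilde hlt.le r (h r hr)).1 ((hstar U).1 hU r hr)
      have h' := this n R.1
      rw [overlay_of_mem _ _ (Set.mem_univ _)] at h'
      exact h'
  have hsplit : (∀ r ∈ Pr, r.tilde.Realize I (Fin.elim0 : Fin 0 → M)) ↔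
      (∀ r ∈ Pr, r.ConstraintHolds I) ∧ ∀ r ∈ Pr, r.ReductClosed I I := by
    simp only [CoreRule.realize_tilde, forall_and]
  rw [← and_assoc, ← hsplit]
  exact (and_congr_left' hholds).trans (and_congr_right key)

end Reduct

namespace CoreProgram

/-! ### Model conditions of the modules, in terms of rules -/

section Modules

variable {L : FirstOrder.Language.{u, v}} {M : Type w} [L.Structure M]

lemma gModule_holds_iff (Pr : CoreProgram L) (P : PredSym L) :
    (Pr.gModule P).Holds M ↔
      ∀ d : Fin P.1 → M, predInterp L M P.1 P.2 d →
        ∃ (k : ℕ) (A : PredAtom L k) (B : Body L k) (e : Fin k → M),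
          .choice A B ∈ Pr ∧ A.sym = P ∧
          (⟨A.arity, fun i => (A.args i).realize e⟩ : Σ n, Fin n → M) = ⟨P.1, d⟩ ∧
          B.Sat (predInterp L M) (predInterp L M) e := by
  refine forall_congr' fun d => imp_congr_right fun _ => ?_
  constructor
  · rintro ⟨ρ, ⟨⟨r, hr, hρ⟩, hP⟩, e, heq, hB⟩
    cases r with
    | choice A B =>
      obtain rfl := Option.some.inj hρ
      exact ⟨_, A, B, e, hr, hP, heq, (B.realize_toFormula _ _).1 hB⟩
    | normal A B => cases hρ
    | constraint B => cases hρ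
  · rintro ⟨k, A, B, e, hr, hP, heq, hB⟩
    exact ⟨⟨k, A, B.toFormula⟩, ⟨⟨_, hr, rfl⟩, hP⟩, e, heq, (B.realize_toFormula _ _).2 hB⟩

variable [Finite (PredSym L)]

lemma dModule_pairSat_iff (Pr : CoreProgram L) (V I : Interp L.Relations M) :
    (∀ ρ ∈ Pr.dModule.rules, ρ.PairSat V I) ↔
      ∀ (k : ℕ) (A : PredAtom L k) (B : Body L k), .normal A B ∈ Pr →
        ∀ e, B.Sat V I e → A.Sat V e := by
  constructor
  · intro h k A B hr e hB
    exact h ⟨k, A, B.toFormula⟩ ⟨_, hr, rfl⟩ e ((B.pairSat_toFormula _ _ _).2 hB)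
  · rintro h ρ ⟨r, hr, hρ⟩ e hB
    cases r with
    | choice A B => cases hρ
    | normal A B =>
      obtain rfl := Option.some.inj hρ
      exact h _ A B hr e ((B.pairSat_toFormula _ _ _).1 hB)
    | constraint B => cases hρ

lemma dModule_holds_iff (Pr : CoreProgram L) :
    Pr.dModule.Holds M ↔
      (∀ (k : ℕ) (A : PredAtom L k) (B : Body L k), .normal A B ∈ Pr →
        ∀ e, B.Sat (predInterp L M) (predInterp L M) e → A.Sat (predInterp L M) e) ∧
      ∀ X : Interp (SubPred Pr.dModule.defined) M,
        (∀ (k : ℕ) (A : PredAtom L k) (B : Body L k), .normal A B ∈ Pr →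
          ∀ e, B.Sat (overlay (predInterp L M) X) (predInterp L M) e →
            A.Sat (overlay (predInterp L M) X) e) →
        restrict Pr.dModule.defined (predInterp L M) ≤ X := by
  unfold DModule.Holds DModule.IsStableModel IsLeast lowerBounds
  simp only [Set.mem_ofPred_eq, overlay_restrict, dModule_pairSat_iff]

lemma emptyDefModule_holds_iff (Pr : CoreProgram L) :
    Pr.emptyDefModule.Holds M ↔
      ∀ (n : ℕ) (R : L.Relations n) (d : Fin n → M), ⟨n, R⟩ ∉ Pr.hd → ¬ predInterp L M n R d := by
  constructor
  · intro h n R d hR hd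
    obtain ⟨-, h⟩ : IsLeast _ _ := h
    -- Without rules, the everywhere false interpretation is an admissible competitor.
    exact h (a := fun _ _ _ => False) (fun ρ hρ => absurd hρ (Set.notMem_empty _)) n ⟨R, hR⟩ d hd
  · intro h
    refine ⟨fun ρ hρ => absurd hρ (Set.notMem_empty _), fun X _ n R d hd => ?_⟩
    exact absurd hd (h n R.1 d R.2)

lemma splitTheory_holds_iff (Pr : CoreProgram L) {n : ℕ} (parts : Fin n → CoreProgram L)
    (hcover : ∀ r, r ∈ Pr ↔ ∃ i, r ∈ parts i) :
    (Pr.splitTheory parts).Holds M ↔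
      (∀ r ∈ Pr, r.ConstraintHolds (predInterp L M)) ∧
      (∀ i P, (∃ r ∈ parts i, r.IsChoiceFor P) → ((parts i).gModule P).Holds M) ∧
      (∀ i, (∃ r ∈ parts i, ∃ P, r.IsNormalFor P) → (parts i).dModule.Holds M) ∧
      Pr.emptyDefModule.Holds M := by
  have hT (k : ℕ) (B : Body L k) : FOSentence.Holds (.alls B.toFormula.neg) M ↔
      (CoreRule.constraint B).ConstraintHolds (predInterp L M) := by
    refine (Formula.realize_alls _ _).trans (forall_congr' fun e => ?_)
    exact not_congr (B.realize_toFormula _ _)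
  constructor
  · intro h
    refine ⟨fun r hr => ?_, fun i P hP => ?_, fun i hi => ?_, ?_⟩
    · cases r with
      | choice A B => trivial
      | normal A B => trivial
      | constraint B =>
        obtain ⟨i, hi⟩ := (hcover _).1 hr
        exact (hT _ B).1 (h _ (.inl (Set.mem_iUnion.2 ⟨i, .inr ⟨_, ⟨_, hi, rfl⟩, rfl⟩⟩)))
    · exact h _ (.inl (Set.mem_iUnion.2 ⟨i, .inl (.inl ⟨P, hP, rfl⟩)⟩))
    · exact h _ (.inl (Set.mem_iUnion.2 ⟨i, .inl (.inr ⟨hi, rfl⟩)⟩))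
    · exact h _ (.inr rfl)
  · rintro ⟨hC, hG, hD, hE⟩ m (hm | rfl)
    · obtain ⟨i, (⟨P, hP, rfl⟩ | ⟨hi, rfl⟩) | ⟨φ, ⟨r, hr, hφ⟩, rfl⟩⟩ := Set.mem_iUnion.1 hm
      · exact hG i P hP
      · exact hD i hi
      · cases r with
        | choice A B => cases hφ
        | normal A B => cases hφ
        | constraint B =>
          obtain rfl := Option.some.inj hφ
          exact (hT _ B).2 (hC _ ((hcover _).2 ⟨i, hr⟩))
    · exact hE

end Modules

/-! ### Comparing minimality with the modules of a proper splitting -/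

section Splitting

variable {L : FirstOrder.Language.{u, v}} {M : Type w} [L.Structure M]
  {Pr : CoreProgram L} {n : ℕ} {parts : Fin n → CoreProgram L}

lemma PosDepends.mem_hd {P Q : PredSym L} (h : Pr.PosDepends P Q) : P ∈ Pr.hd := by
  induction h using Relation.TransGen.head_induction_on with
  | single h => exact let ⟨r, hr, hP, _⟩ := h; ⟨r, hr, hP⟩
  | head h _ _ => exact let ⟨r, hr, hP, _⟩ := h; ⟨r, hr, hP⟩

/-- All rules for a choice predicate share one part, and that part cannot also contain a normal
rule. -/
lemma IsProperSplitting.not_choice_normal (hs : Pr.IsProperSplitting parts) {P : PredSym L}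
    {i : Fin n} {r s : CoreRule L} (hr : r ∈ Pr) (hs' : s ∈ parts i) {Q : PredSym L}
    (hrP : r.IsChoiceFor P) (hsQ : s.IsNormalFor Q) {t : CoreRule L} (ht : t ∈ parts i)
    (htP : t.HasHead P) : False := by
  obtain ⟨j, hj⟩ := (hs.cover r).1 hr
  obtain rfl := hs.same_head P j i r hj t ht (.inl hrP) htP
  exact hs.not_mixed j P Q r hj s hs' ⟨hrP, hsQ⟩

lemma IsProperSplitting.gModule_holds (hs : Pr.IsProperSplitting parts)
    (hcl : ∀ r ∈ Pr, r.ReductClosed (predInterp L M) (predInterp L M))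
    (hmin : ∀ V ≤ predInterp L M, (∀ r ∈ Pr, r.ReductClosed (predInterp L M) V) →
      predInterp L M ≤ V)
    (i : Fin n) (P : PredSym L) (hP : ∃ r ∈ parts i, r.IsChoiceFor P) :
    ((parts i).gModule P).Holds M := by
  obtain ⟨r₀, hr₀, hr₀P⟩ := hP
  rw [gModule_holds_iff]
  intro d hd
  by_contra hno
  -- Remove the single unsupported atom `P(d)`. A choice instance deriving it would be a support,
  -- and no normal rule has head `P`, so `V` stays closed.
  let V : Interp L.Relations M := fun m R a => predInterp L M m R a ∧
    ¬ ((⟨m, R⟩ : PredSym L) = P ∧ (⟨m, a⟩ : Σ n, Fin n → M) = ⟨P.1, d⟩)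
  have hV : V ≤ predInterp L M := fun m R a h => h.1
  refine (hmin V hV (fun r hr => ?_) P.1 P.2 d hd).2 ⟨rfl, rfl⟩
  cases r with
  | choice A B =>
    refine fun e hA hB => ⟨hA, fun ⟨h₁, h₂⟩ => hno ?_⟩
    obtain ⟨j, hj⟩ := (hs.cover _).1 hr
    obtain rfl := hs.same_head P j i _ hj r₀ hr₀ (.inl h₁) (.inl hr₀P)
    exact ⟨_, A, B, e, hj, h₁, h₂, hB.mono hV⟩
  | normal A B =>
    refine fun e hB => ⟨hcl _ hr e (hB.mono hV), fun ⟨h₁, _⟩ => ?_⟩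
    obtain ⟨j, hj⟩ := (hs.cover _).1 hr
    exact hs.not_choice_normal ((hs.cover _).2 ⟨i, hr₀⟩) hj hr₀P h₁ hj (.inr h₁)
  | constraint B => trivial

lemma IsProperSplitting.dModule_holds [Finite (PredSym L)] (hs : Pr.IsProperSplitting parts)
    (hcl : ∀ r ∈ Pr, r.ReductClosed (predInterp L M) (predInterp L M))
    (hmin : ∀ V ≤ predInterp L M, (∀ r ∈ Pr, r.ReductClosed (predInterp L M) V) →
      predInterp L M ≤ V)
    (i : Fin n) : (parts i).dModule.Holds M := by
  rw [dModule_holds_iff]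
  refine ⟨fun k A B hr => hcl _ ((hs.cover _).2 ⟨i, hr⟩), fun X hX => ?_⟩
  -- The competitor `X` need not lie below `I`, whereas minimality of an answer set only tests
  -- interpretations below `I`; hence the meet.
  let V : Interp L.Relations M := overlay (predInterp L M) X ⊓ predInterp L M
  have hV : V ≤ predInterp L M := inf_le_right
  have hIV : predInterp L M ≤ V := by
    refine hmin V hV fun r hr => ?_
    cases r with
    | choice A B =>
      refine fun e hA hB => ⟨?_, hA⟩
      rw [overlay_of_notMem]
      · exact hA
      · rintro ⟨s, hs', hsA⟩
        exact hs.not_choice_normal hr hs' rfl hsA hs' (.inr hsA)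
    | normal A B =>
      intro e hB
      have hA := hcl _ hr e (hB.mono hV)
      refine ⟨?_, hA⟩
      by_cases hd : (⟨A.arity, A.rel⟩ : PredSym L) ∈ (parts i).dModule.defined
      -- A head defined in part `i` forces the whole rule into that part, where closure of `X`
      -- applies.
      · obtain ⟨s, hs', hsA⟩ := hd
        obtain ⟨j, hj⟩ := (hs.cover _).1 hr
        obtain rfl := hs.same_head _ j i _ hj s hs' (.inr rfl) (.inr hsA)
        exact hX _ A B hj e (hB.mono inf_le_left)
      · rw [overlay_of_notMem _ _ hd]
        exact hA
    | constraint B => trivial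
  intro m R a h
  have h' := (hIV m R.1 a h).1
  rwa [overlay_of_mem _ _ R.2] at h'

lemma not_holds_of_notMem_hd
    (hcl : ∀ r ∈ Pr, r.ReductClosed (predInterp L M) (predInterp L M))
    (hmin : ∀ V ≤ predInterp L M, (∀ r ∈ Pr, r.ReductClosed (predInterp L M) V) →
      predInterp L M ≤ V)
    (m : ℕ) (R : L.Relations m) (d : Fin m → M) (hR : ⟨m, R⟩ ∉ Pr.hd) :
    ¬ predInterp L M m R d := by
  intro hd
  let V : Interp L.Relations M := fun m R a => predInterp L M m R a ∧ ⟨m, R⟩ ∈ Pr.hd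
  have hV : V ≤ predInterp L M := fun m R a h => h.1
  refine hR (hmin V hV (fun r hr => ?_) m R d hd).2
  cases r with
  | choice A B => exact fun e hA hB => ⟨hA, _, hr, .inl rfl⟩
  | normal A B => exact fun e hB => ⟨hcl _ hr e (hB.mono hV), _, hr, .inr rfl⟩
  | constraint B => trivial

/-- Mutual dependency produces cycles; discarding it leaves a strict order on a finite set. -/
lemma wellFounded_strict_posDepends [Finite (PredSym L)] (Pr : CoreProgram L) :
    WellFounded fun Q P => Pr.PosDepends P Q ∧ ¬ Pr.PosDepends Q P := by
  have : IsTrans (PredSym L) fun Q P => Pr.PosDepends P Q ∧ ¬ Pr.PosDepends Q P :=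
    ⟨fun a b c hab hbc => ⟨hbc.1.trans hab.1, fun h => hab.2 (h.trans hbc.1)⟩⟩
  have : Std.Irrefl fun Q P => Pr.PosDepends P Q ∧ ¬ Pr.PosDepends Q P :=
    ⟨fun a h => h.2 h.1⟩
  exact Finite.wellFounded_of_trans_of_irrefl _

lemma IsProperSplitting.le_of_reductClosed [Finite (PredSym L)]
    (hs : Pr.IsProperSplitting parts)
    (hG : ∀ i P, (∃ r ∈ parts i, r.IsChoiceFor P) → ((parts i).gModule P).Holds M)
    (hD : ∀ i, (∃ r ∈ parts i, ∃ P, r.IsNormalFor P) → (parts i).dModule.Holds M)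
    (hE : Pr.emptyDefModule.Holds M)
    {V : Interp L.Relations M} (hV : V ≤ predInterp L M)
    (hcl : ∀ r ∈ Pr, r.ReductClosed (predInterp L M) V) : predInterp L M ≤ V := by
  suffices h : ∀ P : PredSym L, predInterp L M P.1 P.2 ≤ V P.1 P.2 from fun m R => h ⟨m, R⟩
  intro P
  induction P using (wellFounded_strict_posDepends Pr).induction with
  | _ P ih =>
  intro d hd
  by_cases hP : P ∈ Pr.hd
  swap
  · exact absurd hd ((emptyDefModule_holds_iff Pr).1 hE P.1 P.2 d hP)
  obtain ⟨r, hr, hrP⟩ := hP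
  obtain ⟨i, hi⟩ := (hs.cover r).1 hr
  rcases hrP with hrP | hrP
  · obtain ⟨k, A, B, e, hAB, hA, heq, hB⟩ :=
      ((gModule_holds_iff _ _).1 (hG i P ⟨r, hi, hrP⟩)) d hd
    have hAB' := (hs.cover _).2 ⟨i, hAB⟩
    -- Dependency of `Q` back on `P` would make the choice predicate `P` recursive, so `Q` is
    -- strictly lower.
    have hBV : B.Sat V (predInterp L M) e := hB.imp fun Q hQ hQI => by
      have hdep : Pr.PosDepends P Q.sym := .single ⟨_, hAB', .inl hA, Q, hQ, rfl⟩
      exact ih Q.sym ⟨hdep, fun h => hs.choice_not_recursive P r hr hrP (hdep.trans h)⟩ _ hQI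
    obtain ⟨m, R, ts⟩ := A
    subst hA
    obtain rfl := eq_of_heq (Sigma.mk.inj heq).2
    exact hcl _ hAB' e hd hBV
  -- A part may contain several dependency classes, some not below `P`, about which the induction
  -- says nothing. The competitor therefore follows `V` only on the class `C` of `P`.
  · let C : Set (PredSym L) := {Q | Q = P ∨ Pr.PosDepends P Q ∧ Pr.PosDepends Q P}
    let D := (parts i).dModule
    have hCD : C ⊆ D.defined := by
      -- Mutual dependency puts the rules for `Q` in the part of `P`; that part has a normal rule,
      -- so they are normal too.
      rintro Q (rfl | ⟨hPQ, hQP⟩)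
      · exact ⟨r, hi, hrP⟩
      · obtain ⟨s, hs', hsQ⟩ := hQP.mem_hd
        obtain ⟨j, hj⟩ := (hs.cover s).1 hs'
        obtain rfl := hs.mutual_dep P Q hPQ hQP i j r hi s hj (.inr hrP) hsQ
        rcases hsQ with hsQ | hsQ
        · exact (hs.not_mixed i Q P s hj r hi ⟨hsQ, hrP⟩).elim
        · exact ⟨s, hj, hsQ⟩
    classical
    let X : Interp (SubPred D.defined) M := fun m R =>
      if (⟨m, R.1⟩ : PredSym L) ∈ C then V m R.1 else predInterp L M m R.1
    have hXC {m : ℕ} {R : L.Relations m} (h : (⟨m, R⟩ : PredSym L) ∈ C) :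
        overlay (predInterp L M) X m R = V m R := by
      rw [overlay_of_mem _ _ (hCD h)]
      exact if_pos h
    have hXnC {m : ℕ} {R : L.Relations m} (h : (⟨m, R⟩ : PredSym L) ∉ C) :
        overlay (predInterp L M) X m R = predInterp L M m R := by
      by_cases hR : (⟨m, R⟩ : PredSym L) ∈ D.defined
      · rw [overlay_of_mem _ _ hR]
        exact if_neg h
      · exact overlay_of_notMem _ _ hR
    have hXI : overlay (predInterp L M) X ≤ predInterp L M := by
      intro m R
      by_cases h : (⟨m, R⟩ : PredSym L) ∈ C
      · rw [hXC h]; exact hV m R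
      · rw [hXnC h]
    obtain ⟨hDcl, hDmin⟩ := (dModule_holds_iff _).1 (hD i ⟨r, hi, P, hrP⟩)
    have hPX := hDmin X fun k A B hAB e hB => ?_
    · have := hPX P.1 ⟨P.2, hCD (.inl rfl)⟩ d hd
      rwa [show X P.1 ⟨P.2, hCD (.inl rfl)⟩ = V P.1 P.2 from if_pos (.inl rfl)] at this
    by_cases hA : A.sym ∈ C
    · have hAB' := (hs.cover _).2 ⟨i, hAB⟩
      have hAV : A.Sat V e := hcl _ hAB' e <| hB.imp fun Q hQ hQX => by
        -- Inside `C` the overlay already is `V`; a body predicate outside `C` is strictly below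
        -- `P`, so its truth passes from `I` to `V` by induction.
        by_cases hQC : Q.sym ∈ C
        · unfold PredAtom.Sat at hQX
          rwa [hXC hQC] at hQX
        · have hAQ : Pr.PosDepends A.sym Q.sym := .single ⟨_, hAB', .inr rfl, Q, hQ, rfl⟩
          have hPQ : Pr.PosDepends P Q.sym := by
            rcases hA with hA | hA
            · exact hA ▸ hAQ
            · exact hA.1.trans hAQ
          exact ih Q.sym ⟨hPQ, fun h => hQC (.inr ⟨hPQ, h⟩)⟩ _ (hXI _ _ _ hQX)
      unfold PredAtom.Sat
      rw [hXC hA]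
      exact hAV
    · unfold PredAtom.Sat
      rw [hXnC hA]
      -- A head outside `C` has its value in `I`, and the overlay lies below `I`, so closure of `I`
      -- suffices.
      exact hDcl _ A B hAB e (hB.mono hXI)

end Splitting

end CoreProgram

end ASPFO

theorem mainTheorem2
    {L : FirstOrder.Language.{u, v}}
    [Finite (Σ n : ℕ, L.Functions n)] [Finite (Σ n : ℕ, L.Relations n)]
    (Pr : ASPFO.CoreProgram L) {n : ℕ} (parts : Fin n → ASPFO.CoreProgram L)
    (hsplit : Pr.IsProperSplitting parts)
    (M : Type w) [L.Structure M] [Nonempty M] :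
    Pr.IsGeneralAnswerSet M ↔ (Pr.splitTheory parts).Holds M := by
  rw [ASPFO.CoreProgram.isGeneralAnswerSet_iff,
    ASPFO.CoreProgram.splitTheory_holds_iff Pr parts hsplit.cover]
  refine and_congr_right fun _ => ⟨?_, ?_⟩
  · rintro ⟨hcl, hmin⟩
    exact ⟨hsplit.gModule_holds hcl hmin, fun i _ => hsplit.dModule_holds hcl hmin i,
      (ASPFO.CoreProgram.emptyDefModule_holds_iff Pr).2
        (ASPFO.CoreProgram.not_holds_of_notMem_hd hcl hmin)⟩
  · rintro ⟨hG, hD, hE⟩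
    refine ⟨fun r hr => ?_, fun V hV hcl => hsplit.le_of_reductClosed hG hD hE hV hcl⟩
    -- Choice rules impose nothing on `I` itself, and closure under normal rules is the closure half
    -- of the D-modules.
    cases r with
    | choice A B => exact fun e hA _ => hA
    | normal A B =>
      obtain ⟨i, hi⟩ := (hsplit.cover _).1 hr
      exact ((ASPFO.CoreProgram.dModule_holds_iff _).1 (hD i ⟨_, hi, A.sym, rfl⟩)).1 _ A B hi
    | constraint B => trivial
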